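/- Let $p$ be a prime and let $n,k\ge 0$ be integers with $k\ge n/2$. Let $PG(n,p)$ be the $n$-dimensional projective space over $\mathbb{F}_p$, and let $C_k(n,p)$ be the $p$-ary linear code spanned over $\mathbb{F}_p$ by the rows of the incidence matrix of points and $k$-spaces of $PG(n,p)$ (rows indexed by the $k$-dimensional projective subspaces, columns by the points, entry $1$ if the point lies on the $k$-space and $0$ otherwise; if $k>n$ there are no rows and the code is zero). The weight of a codeword is the number of its nonzero coordinates. Put $\theta_k=(p^{k+1}-1)/(p-1)$, the number of points of a $k$-dimensional projective space over $\mathbb{F}_p$. Then $C_k(n,p)$ contains no codeword whose weight lies in the open interval $(\theta_k,\,2p^k)$. -/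

import Mathlib

open scoped LinearAlgebra.Projectivization

noncomputable section

namespace PGCode

/-- The point set of the projective space `PG(n, K)`, i.e. of `PG(n, q)` when `K = 𝔽_q`. -/
abbrev Point (n : ℕ) (K : Type*) [Field K] : Type _ :=
  ℙ K (Fin (n + 1) → K)

/-- The `k`-spaces of `PG(n, K)`: subspaces of projective dimension `k`, that is,
linear subspaces of `K ^ (n + 1)` of linear dimension `k + 1`. -/
abbrev KSpace (n k : ℕ) (K : Type*) [Field K] : Type _ :=
  {W : Submodule K (Fin (n + 1) → K) // Module.finrank K W = k + 1}

open Classical in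
/-- The incidence matrix of points and `k`-spaces of `PG(n, K)`, with entries in `R`: rows are
indexed by the `k`-spaces, columns by the points, and an entry is `1` if the point lies on the
`k`-space and `0` otherwise. -/
def incidenceMatrix (n k : ℕ) (K R : Type*) [Field K] [CommRing R] :
    Matrix (KSpace n k K) (Point n K) R :=
  Matrix.of fun W P => if P.submodule ≤ W.1 then 1 else 0

/-- The `p`-ary linear code of points and `k`-spaces of `PG(n, K)`: the `𝔽_p`-span of the rows of
the incidence matrix. For `K = 𝔽_q` with `q` a power of the prime `p` this is `C_k(n, q)`. -/
def code (p n k : ℕ) (K : Type*) [Field K] : Submodule (ZMod p) (Point n K → ZMod p) :=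
  Submodule.span (ZMod p) (Set.range (incidenceMatrix n k K (ZMod p)).row)

/-- The weight of a vector: the number of its nonzero positions. -/
def wt {ι R : Type*} [Zero R] (c : ι → R) : ℕ :=
  (Function.support c).ncard

/-- `θ_m = (q ^ (m + 1) - 1) / (q - 1)`, the number of points of `PG(m, q)`
(the division is exact for `q ≥ 2`). -/
def theta (q m : ℕ) : ℕ :=
  (q ^ (m + 1) - 1) / (q - 1)

end PGCode

end

namespace PGCode

open MvPolynomial MonomialOrder Finset

/-! Pulled back to homogeneous coordinates, a codeword is a polynomial of degree at most `(n - k)(p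
- 1)` in `n + 1` variables, and its weight times `p - 1` counts the nonzero values away from the
origin. It therefore suffices to find a gap in the number of nonzero values
(`card_support_le_or_le`).

Write `q = t + 1`. The footprint bound makes the support at least as large as the set of reduced
monomials above the leading one, `x^α`. This already gives `2 t q^k` unless `α` equals `t` on
exactly `a` variables and `0` elsewhere, where it gives only `q^(k+1)`. In that case let `A` be the
set of those `a` variables. Either every `x_i` with `i ∈ A` is, on the support, a function of the
variables outside `A`, so the support has at most `q^(k+1)` points; or dividing `x_i P` by `P`
leaves a remainder with a new leading monomial, which enlarges the footprint by `(t - 1) q^k`, for a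
total of `2 t q^k`. -/

/-- For a given sum, the product is smallest when the `c i` are as unequal as possible: `d` of them
equal to `t`, one equal to `r`, the rest `0`. -/
theorem pow_mul_le_prod_one_add {ι : Type*} (t : ℕ) (c : ι → ℕ) (s : Finset ι)
    (hc : ∀ i ∈ s, c i ≤ t) (d r : ℕ) (hr : r ≤ t) (h : d * t + r ≤ ∑ i ∈ s, c i) :
    (1 + r) * (t + 1) ^ d ≤ ∏ i ∈ s, (1 + c i) := by
  classical
  induction s using Finset.induction_on generalizing d r with
  | empty =>
    simp only [sum_empty, nonpos_iff_eq_zero, Nat.add_eq_zero_iff, mul_eq_zero] at h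
    obtain ⟨rfl | rfl, rfl⟩ := h <;> simp
  | insert j s hj ih =>
    rw [prod_insert hj]
    rw [sum_insert hj] at h
    have hj' : c j ≤ t := hc j (mem_insert_self j s)
    have ih' := ih fun i hi => hc i (mem_insert_of_mem hi)
    rcases le_or_gt (c j) r with hx | hx
    · obtain ⟨y, rfl⟩ := Nat.exists_eq_add_of_le hx
      calc (1 + (c j + y)) * (t + 1) ^ d
          ≤ ((1 + c j) * (1 + y)) * (t + 1) ^ d := by gcongr; nlinarith
        _ = (1 + c j) * ((1 + y) * (t + 1) ^ d) := by ring
        _ ≤ _ := by gcongr; exact ih' d y (by omega) (by omega)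
    · cases d with
      | zero =>
        have : 1 ≤ ∏ i ∈ s, (1 + c i) := Finset.one_le_prod' fun i _ => by omega
        nlinarith
      | succ d =>
        obtain ⟨y, hy⟩ := Nat.exists_eq_add_of_le hj'
        -- Exchange: the pair `r, t` has the same sum as `c j, y + r` but is more spread out, so its
        -- product is smaller.
        calc (1 + r) * (t + 1) ^ (d + 1) = ((1 + r) * (1 + t)) * (t + 1) ^ d := by ring
          _ ≤ ((1 + c j) * (1 + (y + r))) * (t + 1) ^ d := by
            refine Nat.mul_le_mul_right _ ?_
            rw [hy]
            nlinarith [Nat.mul_le_mul_left y hx.le]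
          _ = (1 + c j) * ((1 + (y + r)) * (t + 1) ^ d) := by ring
          _ ≤ _ := by
            gcongr
            refine ih' d (y + r) (by omega) ?_
            rw [Nat.succ_mul] at h
            omega

/-! ### Cancelling leading monomials, and reduction by the field equations -/

section LeadingMonomial

variable {σ : Type*} {K : Type*} [Field K]

theorem degree_sub_lt_of_leadingTerm_eq (m : MonomialOrder σ) {P R : MvPolynomial σ K}
    (hd : m.degree P = m.degree R) (hc : m.leadingCoeff P = m.leadingCoeff R)
    (h : P - R ≠ 0) : m.degree (P - R) ≺[m] m.degree P := by
  refine lt_of_le_of_ne ((m.degree_sub_le (f := P) (g := R)).trans (by simp [hd])) fun he => ?_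
  have he : m.degree (P - R) = m.degree P := m.toSyn.injective he
  apply (m.coeff_degree_ne_zero_iff).2 h
  rw [he, coeff_sub, sub_eq_zero]
  nth_rewrite 2 [hd]
  exact hc

theorem exists_forall_not_degree_lt (m : MonomialOrder σ) (𝒬 : Set (MvPolynomial σ K))
    (h : 𝒬.Nonempty) : ∃ Q ∈ 𝒬, ∀ Q' ∈ 𝒬, ¬ m.degree Q' ≺[m] m.degree Q :=
  (InvImage.wf (fun Q => m.toSyn (m.degree Q)) m.wellFoundedLT_syn.wf).has_min 𝒬 h

theorem leadingTerm_mul_monomial (m : MonomialOrder σ) {P : MvPolynomial σ K} (hP : P ≠ 0)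
    {c : K} (hc : c ≠ 0) (d : σ →₀ ℕ) :
    m.degree (monomial d c * P) = d + m.degree P ∧
      m.leadingCoeff (monomial d c * P) = c * m.leadingCoeff P := by
  classical
  refine ⟨?_, by simp⟩
  rw [m.degree_mul (by simpa using hc) hP, m.degree_monomial, if_neg hc]

/-- A leading monomial divisible by that of `P` can be cancelled by a multiple of `P`. -/
theorem exists_sub_monomial_mul (m : MonomialOrder σ) {P Q : MvPolynomial σ K} (hP : P ≠ 0)
    (hQ : Q ≠ 0) (h : m.degree P ≤ m.degree Q) :
    ∃ c : K, Q - monomial (m.degree Q - m.degree P) c * P = 0 ∨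
      m.degree (Q - monomial (m.degree Q - m.degree P) c * P) ≺[m] m.degree Q := by
  have hP' := m.leadingCoeff_ne_zero_iff.2 hP
  have hQ' := m.leadingCoeff_ne_zero_iff.2 hQ
  refine ⟨m.leadingCoeff Q / m.leadingCoeff P, or_iff_not_imp_left.2 fun hne => ?_⟩
  have := leadingTerm_mul_monomial m hP (div_ne_zero hQ' hP') (m.degree Q - m.degree P)
  refine degree_sub_lt_of_leadingTerm_eq m ?_ ?_ hne
  · rw [this.1, tsub_add_cancel_of_le h]
  · rw [this.2, div_mul_cancel₀ _ hP']

variable [Fintype K]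

theorem leadingTerm_X_pow_card_sub_X (m : MonomialOrder σ) (i : σ) :
    m.degree (X i ^ Fintype.card K - X i : MvPolynomial σ K)
        = Finsupp.single i (Fintype.card K) ∧
      (X i ^ Fintype.card K - X i : MvPolynomial σ K) ≠ 0 := by
  have hq : 1 < Fintype.card K := Fintype.one_lt_card
  have h1 : m.degree (X i ^ Fintype.card K : MvPolynomial σ K)
      = Finsupp.single i (Fintype.card K) := by
    rw [m.degree_pow, m.degree_X]; simp
  have h2 : m.degree (X i : MvPolynomial σ K) ≺[m]
      m.degree (X i ^ Fintype.card K : MvPolynomial σ K) := by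
    rw [h1, m.degree_X]
    refine m.toSyn_strictMono ((Finsupp.single_mono hq.le).lt_of_ne fun h => ?_)
    exact hq.ne (Finsupp.single_injective i h)
  have h3 := m.degree_sub_of_lt h2
  rw [h1] at h3
  refine ⟨h3, fun h0 => ?_⟩
  rw [h0, m.degree_zero] at h3
  have := DFunLike.congr_fun h3 i
  rw [Finsupp.coe_zero, Pi.zero_apply, Finsupp.single_eq_same] at this
  omega

/-- An exponent of the leading monomial that reaches the field size can be reduced without changing
the values of the polynomial. -/
theorem exists_eval_eq_degree_lt (m : MonomialOrder σ) {Q : MvPolynomial σ K} (hQ : Q ≠ 0) {i : σ}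
    (hi : Fintype.card K ≤ m.degree Q i) :
    ∃ Q' : MvPolynomial σ K, (∀ v, eval v Q' = eval v Q) ∧
      (Q' = 0 ∨ m.degree Q' ≺[m] m.degree Q) := by
  obtain ⟨hd, hne⟩ := leadingTerm_X_pow_card_sub_X (K := K) m i
  obtain ⟨c, hc⟩ := exists_sub_monomial_mul m hne hQ (by
    rw [hd]; exact Finsupp.single_le_iff.2 hi)
  exact ⟨_, fun v => by simp [FiniteField.pow_card], hc⟩

end LeadingMonomial

/-! ### The footprint bound -/

section Footprint

variable {σ : Type*} [Fintype σ] [LinearOrder σ] {K : Type*} [Field K]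

theorem exists_degree_eq_of_le {S : Finset (σ → K)} {P : MvPolynomial σ K} (hP : P ≠ 0)
    (hS : ∀ v ∉ S, eval v P = 0) {δ : σ → ℕ} (hδ : ⇑(degLex.degree P) ≤ δ) :
    ∃ R : MvPolynomial σ K, R ≠ 0 ∧ ⇑(degLex.degree R) = δ ∧ ∀ v ∉ S, eval v R = 0 := by
  set d := Finsupp.equivFunOnFinite.symm δ
  refine ⟨monomial (d - degLex.degree P) 1 * P, mul_ne_zero (by simp) hP, ?_,
    fun v hv => by simp [hS v hv]⟩
  rw [(leadingTerm_mul_monomial degLex hP one_ne_zero _).1, tsub_add_cancel_of_le (show degLex.degree P ≤ d from hδ)]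
  rfl

variable [Fintype K]

/-- In `degLex` the leading monomial has full total degree, so the combinatorial Nullstellensatz
applies to it. -/
theorem exists_eval_ne_zero_of_degree_lt {P : MvPolynomial σ K} (hP : P ≠ 0)
    (hbox : ∀ i, degLex.degree P i < Fintype.card K) : ∃ v, eval v P ≠ 0 := by
  obtain ⟨v, -, hv⟩ := combinatorial_nullstellensatz_exists_eval_nonzero P (degLex.degree P)
    (degLex.coeff_degree_ne_zero_iff.2 hP) degree_degLexDegree.symm (fun _ => univ)
    (by simpa using hbox)
  exact ⟨v, hv⟩

/-- The footprint bound: a set of points supports at least as many functions as there are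
reduced leading monomials of polynomials vanishing off that set. -/
theorem card_le_card_of_leadingMonomials (S : Finset (σ → K)) (T : Finset (σ → ℕ))
    (hbox : ∀ γ ∈ T, ∀ i, γ i < Fintype.card K)
    (hT : ∀ γ ∈ T, ∃ P : MvPolynomial σ K, P ≠ 0 ∧ ⇑(degLex.degree P) = γ ∧
      ∀ v ∉ S, eval v P = 0) : #T ≤ #S := by
  classical
  choose! P hne hdeg hS using hT
  -- Restriction to `S` is injective on the span of the `P γ`: their leading monomials are distinct,
  -- so a nontrivial combination has a reduced leading monomial and takes a nonzero value,
  -- necessarily on `S`.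
  let φ : (T → K) →ₗ[K] (S → K) :=
    { toFun := fun c v => ∑ γ : T, c γ * eval v.1 (P γ)
      map_add' := fun c d => by ext v; simp [add_mul, sum_add_distrib]
      map_smul' := fun r c => by ext v; simp [mul_sum, mul_assoc] }
  have hφ : Function.Injective φ := by
    rw [injective_iff_map_eq_zero]
    intro c hc
    by_contra hc0
    obtain ⟨γ₁, hγ₁⟩ : ∃ γ, c γ ≠ 0 := Function.ne_iff.1 hc0
    obtain ⟨γ₀, hγ₀, hmax⟩ := (univ.filter fun γ : T => c γ ≠ 0).exists_max_image
      (fun γ => degLex.toSyn (degLex.degree (P γ))) ⟨γ₁, by simpa using hγ₁⟩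
    simp only [mem_filter, mem_univ, true_and] at hγ₀ hmax
    set Q : MvPolynomial σ K := ∑ γ : T, C (c γ) * P γ with hQ
    have hcoeff : coeff (degLex.degree (P γ₀)) Q = c γ₀ * degLex.leadingCoeff (P γ₀) := by
      rw [hQ, coeff_sum, sum_eq_single γ₀]
      · rw [coeff_C_mul]; rfl
      · intro γ _ hγ
        rw [coeff_C_mul]
        by_cases hcγ : c γ = 0
        · simp [hcγ]
        rw [degLex.coeff_eq_zero_of_lt, mul_zero]
        refine lt_of_le_of_ne (hmax γ hcγ) fun h => hγ ?_
        have h := congrArg (fun x : σ →₀ ℕ => (x : σ → ℕ)) (degLex.toSyn.injective h)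
        simp only [hdeg _ γ.2, hdeg _ γ₀.2] at h
        exact Subtype.ext h
      · simp
    have hcoeff0 : coeff (degLex.degree (P γ₀)) Q ≠ 0 := by
      rw [hcoeff]
      exact mul_ne_zero hγ₀ (degLex.leadingCoeff_ne_zero_iff.2 (hne _ γ₀.2))
    have hQ0 : Q ≠ 0 := fun h => hcoeff0 (by simp [h])
    have hdQ : degLex.degree Q = degLex.degree (P γ₀) := by
      apply degLex.toSyn.injective
      refine le_antisymm ?_ (degLex.le_degree (mem_support_iff.2 hcoeff0))
      rw [degLex.degree_le_iff]
      intro b hb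
      by_contra hlt
      rw [not_le] at hlt
      refine mem_support_iff.1 hb ?_
      rw [hQ, coeff_sum]
      refine sum_eq_zero fun γ _ => ?_
      rw [coeff_C_mul]
      by_cases hcγ : c γ = 0
      · simp [hcγ]
      rw [degLex.coeff_eq_zero_of_lt ((hmax γ hcγ).trans_lt hlt), mul_zero]
    obtain ⟨v, hv⟩ := exists_eval_ne_zero_of_degree_lt hQ0 fun i => by
      rw [hdQ, hdeg _ γ₀.2]; exact hbox _ γ₀.2 i
    apply hv
    rw [hQ, map_sum]
    by_cases hvS : v ∈ S
    · simpa [φ] using congrFun hc ⟨v, hvS⟩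
    · exact sum_eq_zero fun γ _ => by simp [hS γ γ.2 v hvS]
  simpa using LinearMap.finrank_le_finrank_of_injective hφ

theorem card_Icc_le {S : Finset (σ → K)} {P : MvPolynomial σ K} {t : ℕ}
    (ht : Fintype.card K = t + 1) (hP : P ≠ 0) (hS : ∀ v ∉ S, eval v P = 0)
    (hbox : ∀ i, degLex.degree P i ≤ t) :
    ∏ i, (1 + (t - degLex.degree P i)) ≤ #S := by
  classical
  have := card_le_card_of_leadingMonomials S (Icc (degLex.degree P) fun _ => t)
    (fun γ hγ i => by have : γ i ≤ t := (mem_Icc.1 hγ).2 i; omega)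
    (fun γ hγ => exists_degree_eq_of_le hP hS (mem_Icc.1 hγ).1)
  rw [Pi.card_Icc] at this
  convert this using 2 with i
  rw [Nat.card_Icc]
  have := hbox i
  omega

/-- The footprint bound for two leading monomials, the first of which has a maximal exponent
that the second does not have. -/
theorem card_Icc_add_card_Icc_le {S : Finset (σ → K)} {P Q : MvPolynomial σ K} {t : ℕ}
    (ht : Fintype.card K = t + 1) (hP : P ≠ 0) (hQ : Q ≠ 0) (hPS : ∀ v ∉ S, eval v P = 0)
    (hQS : ∀ v ∉ S, eval v Q = 0) (hPt : ∀ i, degLex.degree P i ≤ t)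
    (hQt : ∀ i, degLex.degree Q i ≤ t) {j : σ} (hPj : degLex.degree P j = t)
    (hQj : degLex.degree Q j < t) :
    ∏ i, (1 + (t - degLex.degree P i)) +
      (t - degLex.degree Q j) * ∏ i ∈ univ.erase j, (1 + (t - degLex.degree Q i)) ≤ #S := by
  classical
  -- Capping the second box at `t - 1` in direction `j` separates it from the first, where that
  -- exponent is `t`.
  have hdisj : Disjoint (Icc (⇑(degLex.degree P)) fun _ => t)
      (Icc (⇑(degLex.degree Q)) (Function.update (fun _ => t) j (t - 1))) := by
    rw [Finset.disjoint_left]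
    intro γ h1 h2
    have h1 : degLex.degree P j ≤ γ j := (mem_Icc.1 h1).1 j
    have h2 : γ j ≤ _ := (mem_Icc.1 h2).2 j
    rw [Function.update_self] at h2
    omega
  have := card_le_card_of_leadingMonomials S ((Icc (⇑(degLex.degree P)) fun _ => t) ∪
      (Icc (⇑(degLex.degree Q)) (Function.update (fun _ => t) j (t - 1))))
    (fun γ hγ i => by
      rcases mem_union.1 hγ with hγ | hγ
      · have : γ i ≤ t := (mem_Icc.1 hγ).2 i
        omega
      · have : γ i ≤ _ := (mem_Icc.1 hγ).2 i
        rw [Function.update_apply] at this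
        split_ifs at this <;> omega)
    (fun γ hγ => by
      rcases mem_union.1 hγ with hγ | hγ
      · exact exists_degree_eq_of_le hP hPS (mem_Icc.1 hγ).1
      · exact exists_degree_eq_of_le hQ hQS (mem_Icc.1 hγ).1)
  rw [card_union_of_disjoint hdisj, Pi.card_Icc, Pi.card_Icc] at this
  convert this using 2
  · refine prod_congr rfl fun i _ => ?_
    rw [Nat.card_Icc]
    have := hPt i
    omega
  · rw [← mul_prod_erase univ _ (mem_univ j)]
    congr 1
    · rw [Nat.card_Icc, Function.update_self]; omega
    · refine prod_congr rfl fun i hi => ?_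
      rw [Nat.card_Icc, Function.update_of_ne (ne_of_mem_erase hi)]
      have := hQt i
      omega

end Footprint

/-! ### Counting bounds for the extremal case -/

theorem card_le_pow_of_dependsOn {σ K : Type*} [Fintype σ] [DecidableEq σ] [Fintype K]
    (S : Finset (σ → K)) (A : Finset σ)
    (h : ∀ i ∈ A, ∃ L : (σ → K) → K, (∀ v w, (∀ j ∉ A, v j = w j) → L v = L w) ∧
      ∀ v ∈ S, v i = L v) : #S ≤ Fintype.card K ^ #Aᶜ := by
  have hinj : Set.InjOn (fun (v : σ → K) (j : (Aᶜ : Finset σ)) => v j) S := by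
    intro v hv w hw hvw
    have hvw' : ∀ j ∉ A, v j = w j := fun j hj => congrFun hvw ⟨j, by simpa using hj⟩
    ext i
    by_cases hi : i ∈ A
    · obtain ⟨L, hL, hLS⟩ := h i hi
      rw [hLS v hv, hLS w hw, hL v w hvw']
    · exact hvw' i hi
  have := card_le_card_of_injOn (t := univ) _ (fun _ _ => mem_univ _) hinj
  simpa only [card_univ, Fintype.card_fun, Fintype.card_coe] using this

/-- If a maximal exponent is diminished, the box above a monomial of degree at most `a t + 1` has
at least `(t - 1) (t + 1) ^ k` elements outside of the maximal slice. -/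
theorem le_mul_prod_erase {σ : Type*} [Fintype σ] [DecidableEq σ] {t a k : ℕ} (ht : 2 ≤ t) (hσ : Fintype.card σ = a + k + 1) (β : σ → ℕ)
    (hβ : ∀ i, β i ≤ t) (hsum : ∑ i, β i ≤ a * t + 1) {j : σ} (hj : β j < t) :
    (t - 1) * (t + 1) ^ k ≤ (t - β j) * ∏ i ∈ univ.erase j, (1 + (t - β i)) := by
  have htot : ∑ i, (t - β i) + ∑ i, β i = (a + k + 1) * t := by
    rw [← sum_add_distrib, sum_congr rfl fun i _ => Nat.sub_add_cancel (hβ i)]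
    simp [hσ]
  have hrest := add_sum_erase univ (fun i => t - β i) (mem_univ j)
  obtain ⟨e, he⟩ : ∃ e, t - β j = e := ⟨_, rfl⟩
  simp only [he] at hrest ⊢
  have he1 : 1 ≤ e := by omega
  have het : e ≤ t := by omega
  have hs : k * t + t ≤ e + 1 + ∑ i ∈ univ.erase j, (t - β i) := by nlinarith
  have key := pow_mul_le_prod_one_add t (fun i => t - β i) (univ.erase j) fun i _ => Nat.sub_le t _
  -- For `e < t` the other factors contribute `(t - e) q^k`, and `e (t - e) ≥ t - 1`. For `e = t`
  -- one unit is missing from their sum, hence the split of `k`.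
  rcases het.lt_or_eq with hlt | rfl
  · have := key k (t - 1 - e) (by omega) (by omega)
    calc (t - 1) * (t + 1) ^ k ≤ (e * (1 + (t - 1 - e))) * (t + 1) ^ k := by
          refine Nat.mul_le_mul_right _ ?_
          obtain ⟨u, rfl⟩ := Nat.exists_eq_add_of_lt hlt
          obtain ⟨e, rfl⟩ := Nat.exists_eq_add_of_le he1
          have h1 : 1 + e + u + 1 - 1 = 1 + e + u := by omega
          have h2 : 1 + e + u + 1 - 1 - (1 + e) = u := by omega
          rw [h2, h1]
          nlinarith [Nat.zero_le (e * u)]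
      _ = e * ((1 + (t - 1 - e)) * (t + 1) ^ k) := by ring
      _ ≤ _ := Nat.mul_le_mul_left _ this
  · cases k with
    | zero =>
      have : 1 ≤ ∏ i ∈ univ.erase j, (1 + (e - β i)) := Finset.one_le_prod' fun i _ => by omega
      rw [pow_zero]
      nlinarith [Nat.sub_le e 1]
    | succ k =>
      rw [Nat.succ_mul] at hs
      have := key k (e - 1) (by omega) (by omega)
      calc (e - 1) * (e + 1) ^ (k + 1) = ((e - 1) * (e + 1)) * (e + 1) ^ k := by ring
        _ ≤ (e * (1 + (e - 1))) * (e + 1) ^ k := by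
          refine Nat.mul_le_mul_right _ ?_
          obtain ⟨u, rfl⟩ := Nat.exists_eq_add_of_le he1
          have h1 : 1 + u - 1 = u := by omega
          rw [h1]
          nlinarith
        _ = e * ((1 + (e - 1)) * (e + 1) ^ k) := by ring
        _ ≤ _ := Nat.mul_le_mul_left _ this

/-! ### The gap in the number of nonzero values -/

section SecondWeight

variable {σ : Type*} [Fintype σ] [LinearOrder σ] {K : Type*} [Field K]

theorem totalDegree_le_of_degree_lt {P Q : MvPolynomial σ K} {D : ℕ}
    (h : degLex.degree P ≺[degLex] degLex.degree Q) (hQ : Q.totalDegree ≤ D) :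
    P.totalDegree ≤ D :=
  (degLex_totalDegree_monotone h.le).trans hQ

theorem totalDegree_eq_sum (P : MvPolynomial σ K) :
    P.totalDegree = ∑ i, degLex.degree P i := by
  rw [← degree_degLexDegree, Finsupp.degree_eq_sum]

variable [Fintype K]

/-- Among nonzero polynomials with the values of `P`, one has a reduced leading monomial. -/
theorem exists_reduced {P : MvPolynomial σ K} {D : ℕ} (hP : P.totalDegree ≤ D)
    (hne : ∃ v, eval v P ≠ 0) :
    ∃ Q : MvPolynomial σ K, (∀ v, eval v Q = eval v P) ∧ Q ≠ 0 ∧ Q.totalDegree ≤ D ∧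
      ∀ i, degLex.degree Q i < Fintype.card K := by
  obtain ⟨Q, ⟨hQP, hQD⟩, hmin⟩ := exists_forall_not_degree_lt degLex
    {Q : MvPolynomial σ K | (∀ v, eval v Q = eval v P) ∧ Q.totalDegree ≤ D} ⟨P, fun _ => rfl, hP⟩
  have hne' : ∀ R : MvPolynomial σ K, (∀ v, eval v R = eval v P) → R ≠ 0 := by
    rintro R hR rfl
    obtain ⟨v, hv⟩ := hne
    exact hv (by rw [← hR, map_zero])
  refine ⟨Q, hQP, hne' Q hQP, hQD, fun i => ?_⟩
  by_contra! hi
  obtain ⟨R, hRQ, hR⟩ := exists_eval_eq_degree_lt degLex (hne' Q hQP) hi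
  have hRP : ∀ v, eval v R = eval v P := fun v => (hRQ v).trans (hQP v)
  have hlt := hR.resolve_left (hne' R hRP)
  exact hmin R ⟨hRP, totalDegree_le_of_degree_lt hlt hQD⟩ hlt

/-- Division of `x_i P` by `P`, whose leading monomial involves exactly the variables in `A`:
either `x_i` is a function of the variables outside `A` on the support of `P`, or there is a
remainder with a leading monomial that is not divisible by that of `P`. -/
theorem exists_dependsOn_or_exists_remainder {P : MvPolynomial σ K} {t D : ℕ} {A : Finset σ}
    (hK : Fintype.card K = t + 1) (hP : P ≠ 0) (hD : P.totalDegree ≤ D)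
    (hA : ∀ j ∈ A, degLex.degree P j = t) (i : σ) :
    (∃ L : (σ → K) → K, (∀ v w, (∀ j ∉ A, v j = w j) → L v = L w) ∧
      ∀ v, eval v P ≠ 0 → v i = L v) ∨
    ∃ Q : MvPolynomial σ K, Q ≠ 0 ∧ (∀ v, eval v P = 0 → eval v Q = 0) ∧
      Q.totalDegree ≤ D + 1 ∧ (∀ j, degLex.degree Q j ≤ t) ∧
      ¬ degLex.degree P ≤ degLex.degree Q := by
  -- Candidate remainders, described by their values so that both division by `P` and reduction by
  -- the field equations stay inside the set; a minimal leading monomial then admits neither.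
  let 𝒬 : Set (MvPolynomial σ K) := {Q | Q.totalDegree ≤ D + 1 ∧
    ∃ L : (σ → K) → K, (∀ v w, (∀ j ∉ A, v j = w j) → L v = L w) ∧
      ∀ v, eval v Q = (v i - L v) * eval v P}
  have h𝒬 : X i * P ∈ 𝒬 := by
    refine ⟨(totalDegree_mul _ _).trans ?_, fun _ => 0, fun _ _ _ => rfl, fun v => by simp⟩
    rw [totalDegree_X]; omega
  by_cases h0 : (0 : MvPolynomial σ K) ∈ 𝒬
  · obtain ⟨-, L, hL, h⟩ := h0
    refine Or.inl ⟨L, hL, fun v hv => ?_⟩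
    have := h v
    rw [map_zero, eq_comm, mul_eq_zero] at this
    exact sub_eq_zero.1 (this.resolve_right hv)
  right
  obtain ⟨Q, hQ𝒬, hmin⟩ := exists_forall_not_degree_lt degLex 𝒬 ⟨_, h𝒬⟩
  obtain ⟨hQD, L, hL, hQ⟩ := id hQ𝒬
  have hQ0 : Q ≠ 0 := fun h => h0 (h ▸ hQ𝒬)
  have hbox : ∀ j, degLex.degree Q j ≤ t := by
    intro j
    by_contra! hj
    obtain ⟨R, hRQ, hR⟩ := exists_eval_eq_degree_lt degLex hQ0 (i := j) (by omega)
    have hL' : ∀ v, eval v R = (v i - L v) * eval v P := fun v => (hRQ v).trans (hQ v)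
    rcases hR with rfl | hlt
    · exact h0 ⟨by simp, L, hL, hL'⟩
    · exact hmin R ⟨totalDegree_le_of_degree_lt hlt hQD, L, hL, hL'⟩ hlt
  refine ⟨Q, hQ0, fun v hv => by rw [hQ, hv, mul_zero], hQD, hbox, fun hle => ?_⟩
  obtain ⟨c, hR⟩ := exists_sub_monomial_mul degLex hP hQ0 hle
  set γ := degLex.degree Q - degLex.degree P with hγ
  -- On `A` the exponents of `P` are already the maximum `t`, so the quotient monomial avoids `A`
  -- and can be absorbed into `L`.
  have hγA : ∀ j ∈ A, γ j = 0 := fun j hj => by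
    have h1 := hbox j
    have h2 := hA j hj
    rw [hγ, Finsupp.tsub_apply]; omega
  have hdep : ∀ v w : σ → K, (∀ j ∉ A, v j = w j) →
      L v + eval v (monomial γ c) = L w + eval w (monomial γ c) := by
    intro v w hvw
    rw [hL v w hvw, eval_monomial, eval_monomial, Finsupp.prod, Finsupp.prod]
    congr 2
    refine prod_congr rfl fun j hj => ?_
    rw [hvw j fun hjA => Finsupp.mem_support_iff.1 hj (hγA j hjA)]
  have heval : ∀ v, eval v (Q - monomial γ c * P)
      = (v i - (L v + eval v (monomial γ c))) * eval v P := fun v => by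
    rw [map_sub, map_mul, hQ]; ring
  rcases hR with hR | hlt
  · exact h0 ⟨by simp, _, hdep, fun v => by rw [← heval, hR]⟩
  · exact hmin _ ⟨totalDegree_le_of_degree_lt hlt hQD, _, hdep, heval⟩ hlt

/-- A polynomial of degree at most `a (q - 1)` in `a + k + 1` variables over a field with
`q = t + 1 ≥ 3` elements has at most `q ^ (k + 1)` or at least `2 (q - 1) q ^ k` nonzero values. -/
theorem card_support_le_or_le {t a k : ℕ} (ht : 2 ≤ t) (hK : Fintype.card K = t + 1)
    (hσ : Fintype.card σ = a + k + 1) (f : MvPolynomial σ K) (hf : f.totalDegree ≤ a * t)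
    (S : Finset (σ → K)) (hS : ∀ v, v ∈ S ↔ eval v f ≠ 0) :
    #S ≤ (t + 1) ^ (k + 1) ∨ 2 * t * (t + 1) ^ k ≤ #S := by
  classical
  rcases S.eq_empty_or_nonempty with rfl | ⟨v₀, hv₀⟩
  · simp
  obtain ⟨P, hPf, hP0, hPD, hPbox⟩ := exists_reduced hf ⟨v₀, (hS v₀).1 hv₀⟩
  replace hS : ∀ v, v ∈ S ↔ eval v P ≠ 0 := fun v => by rw [hPf, hS]
  have hPS : ∀ v ∉ S, eval v P = 0 := fun v hv => by
    by_contra h; exact hv ((hS v).2 h)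
  replace hPbox : ∀ i, degLex.degree P i ≤ t := fun i => by have := hPbox i; omega
  have hcard := card_Icc_le hK hP0 hPS hPbox
  have htot : ∑ i, (t - degLex.degree P i) + ∑ i, degLex.degree P i = (a + k + 1) * t := by
    rw [← sum_add_distrib, sum_congr rfl fun i _ => Nat.sub_add_cancel (hPbox i)]
    simp [hσ]
  have hPD' := hPD
  rw [totalDegree_eq_sum] at hPD'
  by_cases hmid : ∃ i, degLex.degree P i ≠ 0 ∧ degLex.degree P i ≠ t
  · right
    obtain ⟨j, hj0, hjt⟩ := hmid
    have hjt' := hPbox j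
    obtain ⟨e, he⟩ : ∃ e, t - degLex.degree P j = e := ⟨_, rfl⟩
    have hrest := add_sum_erase univ (fun i => t - degLex.degree P i) (mem_univ j)
    simp only [he] at hrest
    have := pow_mul_le_prod_one_add t (fun i => t - degLex.degree P i) (univ.erase j)
      (fun i _ => Nat.sub_le t _) k (t - e) (by omega) (by
        have : e + (t - e) = t := by omega
        nlinarith)
    rw [← mul_prod_erase univ _ (mem_univ j), he] at hcard
    refine le_trans ?_ hcard
    -- Here `0 < e < t`, so `e (t - e) ≥ t - 1`.
    calc 2 * t * (t + 1) ^ k ≤ ((1 + e) * (1 + (t - e))) * (t + 1) ^ k := by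
          refine Nat.mul_le_mul_right _ ?_
          obtain ⟨u, hu⟩ := Nat.exists_eq_add_of_le (show 1 ≤ e by omega)
          obtain ⟨w, hw⟩ := Nat.exists_eq_add_of_le (show 1 ≤ t - e by omega)
          have : t = e + (t - e) := by omega
          rw [hw] at this ⊢
          rw [this, hu]
          nlinarith [Nat.zero_le (u * w)]
      _ = (1 + e) * ((1 + (t - e)) * (t + 1) ^ k) := by ring
      _ ≤ _ := Nat.mul_le_mul_left _ this
  push Not at hmid
  set A : Finset σ := univ.filter fun i => degLex.degree P i = t with hA
  have hAt : ∀ i ∈ A, degLex.degree P i = t := fun i hi => (mem_filter.1 hi).2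
  have hA0 : ∀ i ∉ A, degLex.degree P i = 0 := fun i hi => by
    by_contra h
    exact hi (mem_filter.2 ⟨mem_univ i, hmid i h⟩)
  have hsumA : ∑ i, degLex.degree P i = #A * t := by
    rw [← sum_subset (subset_univ A) fun i _ hi => hA0 i hi, sum_congr rfl hAt]
    simp
  have hAa : #A ≤ a := by
    rw [hsumA] at hPD'
    exact Nat.le_of_mul_le_mul_right hPD' (by omega)
  have hAc : #A + #Aᶜ = a + k + 1 := by rw [card_add_card_compl, hσ]
  have hprod : ∏ i, (1 + (t - degLex.degree P i)) = (t + 1) ^ #Aᶜ := by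
    rw [← prod_subset (subset_univ Aᶜ) fun i _ hi => by
      rw [hAt i (by simpa using hi)]; simp]
    rw [prod_congr rfl fun i hi => by rw [hA0 i (mem_compl.1 hi)]]
    simp [add_comm]
  rw [hprod] at hcard
  rcases hAa.lt_or_eq with hlt | hAa
  · right
    calc 2 * t * (t + 1) ^ k ≤ (t + 1) ^ 2 * (t + 1) ^ k := by
          refine Nat.mul_le_mul_right _ ?_
          nlinarith
      _ = (t + 1) ^ (k + 2) := by ring
      _ ≤ (t + 1) ^ #Aᶜ := Nat.pow_le_pow_right (by omega) (by omega)
      _ ≤ _ := hcard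
  have hAc' : #Aᶜ = k + 1 := by omega
  by_cases hdep : ∀ i ∈ A, ∃ L : (σ → K) → K, (∀ v w, (∀ j ∉ A, v j = w j) → L v = L w) ∧
      ∀ v ∈ S, v i = L v
  · left
    have := card_le_pow_of_dependsOn S A hdep
    rwa [hK, hAc'] at this
  right
  push Not at hdep
  obtain ⟨i, hi, hdep⟩ := hdep
  rcases exists_dependsOn_or_exists_remainder hK hP0 hPD hAt i with ⟨L, hL, hLS⟩ | h
  · obtain ⟨v, hv, hne⟩ := hdep L hL
    exact absurd (hLS v ((hS v).1 hv)) hne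
  obtain ⟨Q, hQ0, hQP, hQD, hQbox, hnle⟩ := h
  obtain ⟨j, hj⟩ : ∃ j, degLex.degree Q j < degLex.degree P j := by
    by_contra! h
    exact hnle h
  have hjA : j ∈ A := by
    by_contra h
    rw [hA0 j h] at hj
    omega
  have hPj := hAt j hjA
  have h1 := card_Icc_add_card_Icc_le hK hP0 hQ0 hPS (fun v hv => hQP v (hPS v hv)) hPbox hQbox
    hPj (by omega)
  rw [totalDegree_eq_sum] at hQD
  have h2 := le_mul_prod_erase ht hσ (degLex.degree Q) hQbox hQD (j := j) (by omega)
  rw [hprod, hAc'] at h1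
  refine le_trans ?_ ((Nat.add_le_add_left h2 _).trans h1)
  obtain ⟨u, rfl⟩ := Nat.exists_eq_add_of_le (show 1 ≤ t by omega)
  rw [Nat.add_sub_cancel_left]
  apply le_of_eq
  ring

end SecondWeight

/-! ### Codewords as polynomials in homogeneous coordinates -/

section Lift

variable {K : Type*} [Field K]

theorem exists_linear_polynomial {σ : Type*} [Fintype σ] (φ : (σ → K) →ₗ[K] K) :
    ∃ P : MvPolynomial σ K, P.totalDegree ≤ 1 ∧ ∀ v, eval v P = φ v := by
  classical
  refine ⟨∑ i, C (φ (Pi.single i 1)) * X i, ?_, fun v => ?_⟩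
  · refine totalDegree_finsetSum_le fun i _ => (totalDegree_mul _ _).trans ?_
    simp
  · simp only [map_sum, map_mul, eval_C, eval_X]
    conv_rhs => rw [LinearMap.pi_apply_eq_sum_univ φ v]
    refine sum_congr rfl fun i _ => ?_
    rw [smul_eq_mul, mul_comm]
    congr 2
    ext j
    simp [Pi.single_apply, eq_comm]

theorem exists_ker_eq {V : Type*} [AddCommGroup V] [Module K V] [FiniteDimensional K V]
    (W : Submodule K V) {a : ℕ} (h : Module.finrank K W + a = Module.finrank K V) :
    ∃ φ : V →ₗ[K] (Fin a → K), LinearMap.ker φ = W := by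
  have hq := W.finrank_quotient_add_finrank
  let e : (V ⧸ W) ≃ₗ[K] (Fin a → K) := LinearEquiv.ofFinrankEq _ _ (by simp; omega)
  exact ⟨e.toLinearMap ∘ₗ W.mkQ, by rw [LinearEquiv.ker_comp, Submodule.ker_mkQ]⟩

open Classical in
/-- The indicator function of a subspace of codimension `a` is a polynomial of degree at most
`a (q - 1)`. -/
theorem exists_indicator_polynomial [Fintype K] {σ : Type*} [Fintype σ] (W : Submodule K (σ → K))
    {a : ℕ} (h : Module.finrank K W + a = Fintype.card σ) :
    ∃ P : MvPolynomial σ K, P.totalDegree ≤ a * (Fintype.card K - 1) ∧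
      ∀ v, eval v P = if v ∈ W then 1 else 0 := by
  obtain ⟨φ, rfl⟩ := exists_ker_eq W (a := a) (by simpa using h)
  choose L hL hLφ using fun j => exists_linear_polynomial (LinearMap.proj j ∘ₗ φ)
  -- By Fermat, each factor is the indicator function of the hyperplane `L j = 0`.
  refine ⟨∏ j, (1 - L j ^ (Fintype.card K - 1)), ?_, fun v => ?_⟩
  · refine (totalDegree_finsetProd _ _).trans ?_
    refine (sum_le_card_nsmul _ _ (Fintype.card K - 1) fun j _ => ?_).trans (by simp)
    refine (totalDegree_sub _ _).trans (max_le (by simp) ?_)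
    exact (totalDegree_pow _ _).trans (by nlinarith [hL j])
  · have hq : Fintype.card K - 1 ≠ 0 := by have := Fintype.one_lt_card (α := K); omega
    simp only [map_prod, map_sub, map_one, map_pow, hLφ, LinearMap.comp_apply, LinearMap.proj_apply]
    split_ifs with hv
    · rw [LinearMap.mem_ker] at hv
      simp [hv, hq]
    · obtain ⟨j, hj⟩ : ∃ j, φ v j ≠ 0 := Function.ne_iff.1 hv
      exact prod_eq_zero (mem_univ j) (by rw [FiniteField.pow_card_sub_one_eq_one _ hj, sub_self])

/-- Codewords are given by polynomials in the homogeneous coordinates. -/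
theorem exists_polynomial_of_mem_code {p n k : ℕ} [Fact p.Prime] (hkn : k ≤ n)
    {c : Point n (ZMod p) → ZMod p} (hc : c ∈ code p n k (ZMod p)) :
    ∃ f : MvPolynomial (Fin (n + 1)) (ZMod p), f.totalDegree ≤ (n - k) * (p - 1) ∧
      ∀ v hv, eval v f = c (Projectivization.mk (ZMod p) v hv) := by
  induction hc using Submodule.span_induction with
  | mem c hc =>
    obtain ⟨⟨W, hW⟩, rfl⟩ := hc
    obtain ⟨P, hP, hPW⟩ := exists_indicator_polynomial W (a := n - k) (by
      rw [hW, Fintype.card_fin]; omega)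
    rw [ZMod.card] at hP
    refine ⟨P, hP, fun v hv => ?_⟩
    have hmem : (Projectivization.mk (ZMod p) v hv).submodule ≤ W ↔ v ∈ W := by
      rw [Projectivization.submodule_mk]
      exact Submodule.span_singleton_le_iff_mem v W
    rw [hPW]
    simp only [incidenceMatrix, Matrix.row, Matrix.of_apply]
    by_cases h : v ∈ W
    · rw [if_pos h, if_pos (hmem.2 h)]
    · rw [if_neg h, if_neg (mt hmem.1 h)]
  | zero => exact ⟨0, by simp, by simp⟩
  | add c d _ _ hc hd =>
    obtain ⟨f, hf, hfc⟩ := hc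
    obtain ⟨g, hg, hgd⟩ := hd
    exact ⟨f + g, (totalDegree_add _ _).trans (max_le hf hg), fun v hv => by
      rw [map_add, hfc v hv, hgd v hv]; rfl⟩
  | smul r c _ hc =>
    obtain ⟨f, hf, hfc⟩ := hc
    exact ⟨r • f, (totalDegree_smul_le _ _).trans hf, fun v hv => by
      rw [smul_eval, hfc v hv]; rfl⟩

/-- The units act freely on nonzero vectors, and the points are the orbits. -/
theorem ncard_support_mul_eq [Finite K] {V R : Type*} [AddCommGroup V] [Module K V] [Zero R]
    (c : ℙ K V → R) :
    (Function.support c).ncard * (Nat.card K - 1) =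
      {v : V | ∃ hv : v ≠ 0, c (Projectivization.mk K v hv) ≠ 0}.ncard := by
  have hmk (P : ℙ K V) (u : Kˣ) (h : u • P.rep ≠ 0) : Projectivization.mk K (u • P.rep) h = P := by
    conv_rhs => rw [← P.mk_rep]
    exact (Projectivization.mk_eq_mk_iff K _ _ _ _).2 ⟨u, rfl⟩
  have hne (P : ℙ K V) (u : Kˣ) : u • P.rep ≠ 0 := (smul_ne_zero_iff_ne u).2 P.rep_nonzero
  let φ : Function.support c × Kˣ → {v : V | ∃ hv : v ≠ 0, c (Projectivization.mk K v hv) ≠ 0} :=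
    fun x => ⟨x.2 • x.1.1.rep, hne _ _, by rw [hmk]; exact x.1.2⟩
  have hφ : Function.Bijective φ := by
    constructor
    · rintro ⟨⟨P, hP⟩, u⟩ ⟨⟨Q, hQ⟩, w⟩ h
      have h : u • P.rep = w • Q.rep := congrArg Subtype.val h
      obtain rfl : P = Q := by
        rw [← hmk P u (hne P u), ← hmk Q w (hne Q w)]
        congr 1
      have h' : (u : K) • P.rep = (w : K) • P.rep := h
      rw [Units.ext (smul_left_injective K P.rep_nonzero h')]
    · rintro ⟨v, hv, hcv⟩
      obtain ⟨u, hu⟩ := Projectivization.exists_smul_eq_mk_rep K v hv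
      refine ⟨⟨⟨_, hcv⟩, u⁻¹⟩, Subtype.ext ?_⟩
      simp only [φ]
      rw [← hu, inv_smul_smul]
  rw [← Nat.card_coe_set_eq, ← Nat.card_coe_set_eq, ← Nat.card_congr (Equiv.ofBijective φ hφ),
    Nat.card_prod, Nat.card_units]

end Lift

theorem eq_zero_of_mem_code_of_lt {p n k : ℕ} {K : Type*} [Field K] (hkn : n < k)
    {c : Point n K → ZMod p} (hc : c ∈ code p n k K) : c = 0 := by
  have : IsEmpty (KSpace n k K) := ⟨fun W => by
    have := W.1.finrank_le
    rw [W.2, Module.finrank_fin_fun] at this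
    omega⟩
  rwa [code, Set.range_eq_empty, Submodule.span_empty, Submodule.mem_bot] at hc

theorem theta_mul (q m : ℕ) : theta q m * (q - 1) = q ^ (m + 1) - 1 :=
  Nat.div_mul_cancel (by simpa using Nat.sub_dvd_pow_sub_pow q 1 (m + 1))

end PGCode

/-! ### From nonzero values back to weights -/

theorem mainTheorem5 (p : ℕ) [Fact p.Prime] (n k : ℕ) (hk : (n : ℚ) / 2 ≤ (k : ℚ)) :
    ∀ c ∈ PGCode.code p n k (ZMod p),
      PGCode.wt c ∉ Set.Ioo (PGCode.theta p k) (2 * p ^ k) := by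
  classical
  rintro c hc ⟨hlow, hupp⟩
  obtain hkn | hkn := lt_or_ge n k
  · simp [PGCode.eq_zero_of_mem_code_of_lt hkn hc, PGCode.wt] at hlow
  have hp : p.Prime := Fact.out
  have hθ := PGCode.theta_mul p k
  obtain ⟨t, rfl⟩ : ∃ t, p = t + 1 := ⟨p - 1, by have := hp.two_le; omega⟩
  rw [Nat.add_sub_cancel] at hθ
  obtain rfl | ht : t = 1 ∨ 2 ≤ t := by have := hp.two_le; omega
  -- For `p = 2` the interval is `(2^(k+1) - 1, 2^(k+1))`, which contains no integer.
  · rw [pow_succ, mul_one] at hθ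
    generalize (1 + 1) ^ k = x at hθ hupp
    omega
  obtain ⟨f, hf, hfc⟩ := PGCode.exists_polynomial_of_mem_code hkn hc
  rw [Nat.add_sub_cancel] at hf
  set S : Finset (Fin (n + 1) → ZMod (t + 1)) :=
    Finset.univ.filter fun v => MvPolynomial.eval v f ≠ 0 with hS
  have hcount := PGCode.ncard_support_mul_eq c
  have hset : {v : Fin (n + 1) → ZMod (t + 1) |
      ∃ hv : v ≠ 0, c (Projectivization.mk (ZMod (t + 1)) v hv) ≠ 0} = ↑(S.erase 0) := by
    ext v
    simp only [Set.mem_ofPred_eq, Finset.coe_erase, Set.mem_sdiff, Set.mem_singleton_iff, hS,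
      Finset.coe_filter, Finset.mem_univ, true_and]
    constructor
    · rintro ⟨hv, h⟩
      exact ⟨by rwa [hfc v hv], hv⟩
    · rintro ⟨h, hv⟩
      exact ⟨hv, by rwa [← hfc v hv]⟩
  rw [hset, Set.ncard_coe_finset, Nat.card_zmod, Nat.add_sub_cancel] at hcount
  change PGCode.wt c * t = _ at hcount
  -- The value of `f` at the origin is unconstrained and shifts the count by at most one; the strict
  -- weight bounds, multiplied by `t ≥ 2`, leave room for this.
  have hle : S.card - 1 ≤ (S.erase 0).card := Finset.pred_card_le_card_erase
  have hle' : (S.erase 0).card ≤ S.card := Finset.card_erase_le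
  have hpow : 1 ≤ (t + 1) ^ (k + 1) := Nat.one_le_pow _ _ (by omega)
  have h1 : PGCode.theta (t + 1) k * t + t ≤ PGCode.wt c * t := by
    rw [← Nat.succ_mul]; exact Nat.mul_le_mul_right t hlow
  have h2 : PGCode.wt c * t + t ≤ 2 * t * (t + 1) ^ k := by
    rw [← Nat.succ_mul, mul_right_comm]; exact Nat.mul_le_mul_right t hupp
  rcases PGCode.card_support_le_or_le ht (ZMod.card _) (a := n - k) (k := k)
    (by rw [Fintype.card_fin]; omega) f hf S (by simp [hS]) with h | h <;> omega
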